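/- Let $(X,d)$ be a non-empty metric space, let $\alpha>0$, and let $A$ be a complex Banach algebra (not necessarily unital or commutative) whose set $\Delta(A)$ of non-zero multiplicative linear functionals is non-empty. Let $\mathrm{Lip}_\alpha(X,A)$ be the Banach algebra, under pointwise operations, of all bounded $f:X\to A$ such that $\|f\|:=\sup_{x}\|f(x)\|+\sup_{x\ne y}\|f(x)-f(y)\|/d(x,y)^\alpha<\infty$, with this norm, and let $\mathrm{lip}_\alpha(X,A)$ be its closed subalgebra of those $f$ with $\|f(x)-f(y)\|/d(x,y)^\alpha\to 0$ as $d(x,y)\to 0$. A Banach algebra $B$ is called contractible if for every Banach $B$-bimodule $E$ and every continuous derivation $D:B\to E$ there is $z\in E$ with $D(b)=z\cdot b-b\cdot z$ for all $b\in B$. Second duals carry the first Arens product. (1) Suppose that $\alpha<1$, or, more generally, that $\mathrm{lip}_\alpha(X,\mathbb C)$ separates the points of $X$. Then the following are equivalent: (a) $\mathrm{Lip}_\alpha(X,A)$ is contractible; (b) $\mathrm{lip}_\alpha(X,A)$ is contractible; (c) $X$ is finite and $A$ is contractible. Likewise the following are equivalent: (a') $\mathrm{Lip}_\alpha(X,A)^{**}$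 is contractible; (b') $\mathrm{lip}_\alpha(X,A)^{**}$ is contractible; (c') $X$ is finite and $A^{**}$ is contractible. (2) Suppose that $\alpha\le 1$, or, more generally, that $\mathrm{Lip}_\alpha(X,\mathbb C)$ separates the points of $X$. Then (a) and (c) are equivalent, and (a') and (c') are equivalent. -/

import Mathlib

open Topology

universe u v

/-! ### Contractible Banach algebras -/

/-- A Banach bimodule structure on the Banach space `E` over the Banach algebra `A`: bounded
bilinear left and right actions (`lact a x` is `a · x`, `ract a x` is `x · a`) which are
associative and commute with each other. -/
structure BanachBimodule (A : Type*) [NonUnitalNormedRing A] [NormedSpace ℂ A]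
    (E : Type*) [NormedAddCommGroup E] [NormedSpace ℂ E] where
  lact : A →L[ℂ] E →L[ℂ] E
  ract : A →L[ℂ] E →L[ℂ] E
  lact_mul : ∀ a b x, lact (a * b) x = lact a (lact b x)
  ract_mul : ∀ a b x, ract (a * b) x = ract b (ract a x)
  lact_ract : ∀ a b x, lact a (ract b x) = ract b (lact a x)

namespace BanachBimodule

variable {A : Type*} [NonUnitalNormedRing A] [NormedSpace ℂ A]
  {E : Type*} [NormedAddCommGroup E] [NormedSpace ℂ E]

/-- `D (a b) = D (a) · b + a · D (b)`. -/
def IsDerivation (M : BanachBimodule A E) (D : A →L[ℂ] E) : Prop :=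
  ∀ a b, D (a * b) = M.ract b (D a) + M.lact a (D b)

/-- There is `z` with `D (a) = z · a - a · z` for all `a`. -/
def IsInner (M : BanachBimodule A E) (D : A →L[ℂ] E) : Prop :=
  ∃ z : E, ∀ a, D a = M.ract a z - M.lact a z

end BanachBimodule

/-- `A` is contractible: every continuous derivation from `A` into a Banach `A`-bimodule is
inner. -/
def IsContractibleAlgebra (A : Type u) [NonUnitalNormedRing A] [NormedSpace ℂ A] : Prop :=
  ∀ (E : Type u) [NormedAddCommGroup E] [NormedSpace ℂ E] [CompleteSpace E]
    (M : BanachBimodule A E) (D : A →L[ℂ] E), M.IsDerivation D → M.IsInner D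

/-! ### The second dual with the first Arens product -/

section Bidual

variable (A : Type u) [NonUnitalNormedRing A] [NormedSpace ℂ A]

/-- The second dual `A**`, with the dual norm of the dual norm. -/
def Bidual : Type u := StrongDual ℂ (StrongDual ℂ A)

noncomputable instance : NormedAddCommGroup (Bidual A) :=
  inferInstanceAs (NormedAddCommGroup (StrongDual ℂ (StrongDual ℂ A)))

noncomputable instance : NormedSpace ℂ (Bidual A) :=
  inferInstanceAs (NormedSpace ℂ (StrongDual ℂ (StrongDual ℂ A)))

instance : CompleteSpace (Bidual A) :=
  inferInstanceAs (CompleteSpace (StrongDual ℂ (StrongDual ℂ A)))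

noncomputable instance : FunLike (Bidual A) (StrongDual ℂ A) ℂ :=
  inferInstanceAs (FunLike (StrongDual ℂ (StrongDual ℂ A)) (StrongDual ℂ A) ℂ)

noncomputable instance :
    ContinuousLinearMapClass (Bidual A) ℂ (StrongDual ℂ A) ℂ :=
  inferInstanceAs
    (ContinuousLinearMapClass (StrongDual ℂ (StrongDual ℂ A)) ℂ (StrongDual ℂ A) ℂ)

variable {A}

@[ext] theorem Bidual.ext {m n : Bidual A} (h : ∀ f, m f = n f) : m = n :=
  DFunLike.ext _ _ h

theorem Bidual.add_apply (m n : Bidual A) (f : StrongDual ℂ A) : (m + n) f = m f + n f := rfl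

theorem Bidual.smul_apply (c : ℂ) (m : Bidual A) (f : StrongDual ℂ A) :
    (c • m) f = c * m f := rfl

theorem Bidual.zero_apply (f : StrongDual ℂ A) : (0 : Bidual A) f = 0 := rfl

theorem Bidual.le_opNorm (m : Bidual A) (f : StrongDual ℂ A) : ‖m f‖ ≤ ‖m‖ * ‖f‖ :=
  ContinuousLinearMap.le_opNorm (F := ℂ) (show StrongDual ℂ (StrongDual ℂ A) from m) f

variable [IsScalarTower ℂ A A] [SMulCommClass ℂ A A]

/-- The functional `f · a ∈ A*`, `(f · a) (b) = f (a b)`. -/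
noncomputable def dualAct (f : StrongDual ℂ A) (a : A) : StrongDual ℂ A :=
  f.comp (ContinuousLinearMap.mul ℂ A a)

@[simp] theorem dualAct_apply (f : StrongDual ℂ A) (a b : A) : dualAct f a b = f (a * b) := rfl

theorem norm_dualAct_le (f : StrongDual ℂ A) (a : A) : ‖dualAct f a‖ ≤ ‖f‖ * ‖a‖ :=
  ContinuousLinearMap.opNorm_le_bound _ (by positivity) fun b =>
    calc ‖f (a * b)‖ ≤ ‖f‖ * ‖a * b‖ := f.le_opNorm _
      _ ≤ ‖f‖ * (‖a‖ * ‖b‖) := by gcongr; exact norm_mul_le a b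
      _ = ‖f‖ * ‖a‖ * ‖b‖ := by ring

/-- The functional `n · f ∈ A*`, `(n · f) (a) = n (f · a)`. -/
noncomputable def bidualAct (n : Bidual A) (f : StrongDual ℂ A) : StrongDual ℂ A :=
  LinearMap.mkContinuous
    { toFun := fun a => n (dualAct f a)
      map_add' := fun a b => by
        rw [← map_add]; congr 1; ext c; simp [add_mul]
      map_smul' := fun c a => by
        rw [RingHom.id_apply, ← map_smul]; congr 1; ext b; simp [smul_mul_assoc] }
    (‖n‖ * ‖f‖) fun a =>
      calc ‖n (dualAct f a)‖ ≤ ‖n‖ * ‖dualAct f a‖ := n.le_opNorm _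
        _ ≤ ‖n‖ * (‖f‖ * ‖a‖) := by gcongr; exact norm_dualAct_le f a
        _ = ‖n‖ * ‖f‖ * ‖a‖ := by ring

@[simp] theorem bidualAct_apply (n : Bidual A) (f : StrongDual ℂ A) (a : A) :
    bidualAct n f a = n (dualAct f a) := rfl

theorem norm_bidualAct_le (n : Bidual A) (f : StrongDual ℂ A) :
    ‖bidualAct n f‖ ≤ ‖n‖ * ‖f‖ :=
  LinearMap.mkContinuous_norm_le _ (by positivity) _

/-- The first Arens product on `A**`: `(m n) (f) = m (n · f)`. -/
noncomputable instance : Mul (Bidual A) where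
  mul m n := LinearMap.mkContinuous (E := StrongDual ℂ A) (F := ℂ)
    { toFun := fun f => m (bidualAct n f)
      map_add' := fun f g => by
        rw [← map_add]; congr 1; ext a
        rw [bidualAct_apply, _root_.add_apply, bidualAct_apply, bidualAct_apply,
          ← map_add]
        rfl
      map_smul' := fun c f => by
        rw [RingHom.id_apply, ← map_smul]; congr 1; ext a
        rw [bidualAct_apply, _root_.smul_apply, bidualAct_apply, ← map_smul]
        rfl }
    (‖m‖ * ‖n‖) fun f =>
      calc ‖m (bidualAct n f)‖ ≤ ‖m‖ * ‖bidualAct n f‖ := m.le_opNorm _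
        _ ≤ ‖m‖ * (‖n‖ * ‖f‖) := by gcongr; exact norm_bidualAct_le n f
        _ = ‖m‖ * ‖n‖ * ‖f‖ := by ring

@[simp] theorem Bidual.mul_apply (m n : Bidual A) (f : StrongDual ℂ A) :
    (m * n) f = m (bidualAct n f) := rfl

noncomputable instance : NonUnitalNormedRing (Bidual A) where
  __ := (inferInstance : NormedAddCommGroup (Bidual A))
  __ := (inferInstance : Mul (Bidual A))
  left_distrib m n k := by
    ext f
    rw [Bidual.add_apply, Bidual.mul_apply, Bidual.mul_apply, Bidual.mul_apply, ← map_add]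
    rfl
  right_distrib m n k := by ext f; rfl
  zero_mul m := by ext f; rfl
  mul_zero m := by
    ext f
    rw [Bidual.mul_apply, Bidual.zero_apply, ← map_zero m]
    rfl
  mul_assoc m n k := by
    ext f
    rw [Bidual.mul_apply, Bidual.mul_apply, Bidual.mul_apply]
    congr 1
    ext a
    rw [bidualAct_apply, bidualAct_apply, Bidual.mul_apply]
    congr 1
    ext b
    rw [bidualAct_apply, dualAct_apply, bidualAct_apply]
    congr 1
    ext c
    simp [mul_assoc]
  norm_mul_le m n := LinearMap.mkContinuous_norm_le _ (by positivity) _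

end Bidual

/-! ### Vector-valued Lipschitz algebras -/

section Lipschitz

variable (α : ℝ) (X : Type v) [MetricSpace X] (A : Type u) [NonUnitalNormedRing A]
  [NormedSpace ℂ A]

/-- The bounded functions `f : X → A` with `‖f x - f y‖ ≤ M d(x, y) ^ α` for some `M`, as an
algebra under the pointwise operations. -/
def lipschitzFunctions : NonUnitalSubalgebra ℂ (X → A) where
  carrier := {f | (∃ C : ℝ, ∀ x, ‖f x‖ ≤ C) ∧
    ∃ M : ℝ, ∀ x y, ‖f x - f y‖ ≤ M * dist x y ^ α}
  zero_mem' := ⟨⟨0, by simp⟩, ⟨0, by simp⟩⟩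
  add_mem' := by
    rintro f g ⟨⟨C, hC⟩, M, hM⟩ ⟨⟨C', hC'⟩, M', hM'⟩
    refine ⟨⟨C + C', fun x => (norm_add_le _ _).trans (add_le_add (hC x) (hC' x))⟩,
      M + M', fun x y => ?_⟩
    calc ‖(f + g) x - (f + g) y‖ = ‖(f x - f y) + (g x - g y)‖ := by
          rw [Pi.add_apply, Pi.add_apply, add_sub_add_comm]
      _ ≤ M * dist x y ^ α + M' * dist x y ^ α :=
          (norm_add_le _ _).trans (add_le_add (hM x y) (hM' x y))
      _ = (M + M') * dist x y ^ α := by ring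
  mul_mem' := by
    rintro f g ⟨⟨C, hC⟩, M, hM⟩ ⟨⟨C', hC'⟩, M', hM'⟩
    refine ⟨⟨C * C', fun x => (norm_mul_le _ _).trans
      (mul_le_mul (hC x) (hC' x) (norm_nonneg _) ((norm_nonneg _).trans (hC x)))⟩,
      C * M' + M * C', fun x y => ?_⟩
    calc ‖(f * g) x - (f * g) y‖ = ‖f x * (g x - g y) + (f x - f y) * g y‖ := by
          rw [Pi.mul_apply, Pi.mul_apply, mul_sub, sub_mul, sub_add_sub_cancel]
      _ ≤ ‖f x‖ * ‖g x - g y‖ + ‖f x - f y‖ * ‖g y‖ :=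
          (norm_add_le _ _).trans (add_le_add (norm_mul_le _ _) (norm_mul_le _ _))
      _ ≤ C * (M' * dist x y ^ α) + (M * dist x y ^ α) * C' :=
          add_le_add
            (mul_le_mul (hC x) (hM' x y) (norm_nonneg _) ((norm_nonneg _).trans (hC x)))
            (mul_le_mul (hM x y) (hC' y) (norm_nonneg _) ((norm_nonneg _).trans (hM x y)))
      _ = (C * M' + M * C') * dist x y ^ α := by ring
  smul_mem' := by
    rintro c f ⟨⟨C, hC⟩, M, hM⟩
    refine ⟨⟨‖c‖ * C, fun x => ?_⟩, ‖c‖ * M, fun x y => ?_⟩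
    · rw [Pi.smul_apply, norm_smul]
      exact mul_le_mul_of_nonneg_left (hC x) (norm_nonneg _)
    · rw [Pi.smul_apply, Pi.smul_apply, ← smul_sub, norm_smul, mul_assoc]
      exact mul_le_mul_of_nonneg_left (hM x y) (norm_nonneg _)

/-- The algebra `Lip_α(X, A)`. A type of its own, because its norm is not inherited from
`X → A`. -/
def LipAlgebra : Type max u v := lipschitzFunctions α X A

namespace LipAlgebra

noncomputable instance : NonUnitalRing (LipAlgebra α X A) :=
  inferInstanceAs (NonUnitalRing (lipschitzFunctions α X A))

noncomputable instance : Module ℂ (LipAlgebra α X A) :=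
  inferInstanceAs (Module ℂ (lipschitzFunctions α X A))

instance [IsScalarTower ℂ A A] : IsScalarTower ℂ (LipAlgebra α X A) (LipAlgebra α X A) :=
  inferInstanceAs (IsScalarTower ℂ (lipschitzFunctions α X A) (lipschitzFunctions α X A))

instance [SMulCommClass ℂ A A] : SMulCommClass ℂ (LipAlgebra α X A) (LipAlgebra α X A) :=
  inferInstanceAs (SMulCommClass ℂ (lipschitzFunctions α X A) (lipschitzFunctions α X A))

variable {α X A}

instance : CoeFun (LipAlgebra α X A) fun _ => X → A := ⟨fun f => f.1⟩

@[ext] theorem ext {f g : LipAlgebra α X A} (h : ∀ x, f x = g x) : f = g :=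
  Subtype.ext (funext h)

@[simp] theorem zero_apply (x : X) : (0 : LipAlgebra α X A) x = 0 := rfl
@[simp] theorem add_apply (f g : LipAlgebra α X A) (x : X) : (f + g) x = f x + g x := rfl
@[simp] theorem sub_apply (f g : LipAlgebra α X A) (x : X) : (f - g) x = f x - g x := rfl
@[simp] theorem mul_apply (f g : LipAlgebra α X A) (x : X) : (f * g) x = f x * g x := rfl
@[simp] theorem smul_apply (c : ℂ) (f : LipAlgebra α X A) (x : X) : (c • f) x = c • f x := rfl

/-- The supremum norm. -/
noncomputable def supNorm (f : LipAlgebra α X A) : ℝ := ⨆ x, ‖f x‖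

/-- The difference quotient `‖f x - f y‖ / d(x, y) ^ α`; it is `0` if `x = y`. -/
noncomputable def quot (f : LipAlgebra α X A) (p : X × X) : ℝ :=
  ‖f p.1 - f p.2‖ / dist p.1 p.2 ^ α

/-- The seminorm `p_α`: the supremum of the difference quotients. The pairs `(x, x)` contribute
the value `0` and do not change it. -/
noncomputable def lipSeminorm (f : LipAlgebra α X A) : ℝ := ⨆ p : X × X, f.quot p

theorem quot_nonneg (f : LipAlgebra α X A) (p : X × X) : 0 ≤ f.quot p :=
  div_nonneg (norm_nonneg _) (Real.rpow_nonneg dist_nonneg _)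

theorem norm_sub_eq (f : LipAlgebra α X A) (x y : X) :
    ‖f x - f y‖ = f.quot (x, y) * dist x y ^ α := by
  rcases eq_or_ne x y with rfl | h
  · simp [quot]
  · exact (div_mul_cancel₀ _ (Real.rpow_pos_of_pos (dist_pos.2 h) α).ne').symm

theorem supNorm_bddAbove (f : LipAlgebra α X A) : BddAbove (Set.range fun x => ‖f x‖) := by
  obtain ⟨C, hC⟩ := f.2.1
  exact ⟨C, by rintro _ ⟨x, rfl⟩; exact hC x⟩

theorem quot_bddAbove (f : LipAlgebra α X A) : BddAbove (Set.range f.quot) := by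
  obtain ⟨M, hM⟩ := f.2.2
  refine ⟨max M 0, ?_⟩
  rintro _ ⟨⟨x, y⟩, rfl⟩
  refine div_le_of_le_mul₀ (Real.rpow_nonneg dist_nonneg _) (le_max_right _ _) ?_
  exact (hM x y).trans
    (mul_le_mul_of_nonneg_right (le_max_left _ _) (Real.rpow_nonneg dist_nonneg _))

theorem norm_apply_le_supNorm (f : LipAlgebra α X A) (x : X) : ‖f x‖ ≤ f.supNorm :=
  le_ciSup f.supNorm_bddAbove x

theorem quot_le_lipSeminorm (f : LipAlgebra α X A) (p : X × X) : f.quot p ≤ f.lipSeminorm :=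
  le_ciSup f.quot_bddAbove p

theorem supNorm_nonneg (f : LipAlgebra α X A) : 0 ≤ f.supNorm :=
  Real.iSup_nonneg fun _ => norm_nonneg _

theorem lipSeminorm_nonneg (f : LipAlgebra α X A) : 0 ≤ f.lipSeminorm :=
  Real.iSup_nonneg f.quot_nonneg

theorem norm_sub_le (f : LipAlgebra α X A) (x y : X) :
    ‖f x - f y‖ ≤ f.lipSeminorm * dist x y ^ α := by
  rw [norm_sub_eq]
  exact mul_le_mul_of_nonneg_right (f.quot_le_lipSeminorm _) (Real.rpow_nonneg dist_nonneg _)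

theorem lipSeminorm_le (f : LipAlgebra α X A) {M : ℝ} (hM : 0 ≤ M)
    (h : ∀ x y, ‖f x - f y‖ ≤ M * dist x y ^ α) : f.lipSeminorm ≤ M :=
  Real.iSup_le
    (fun p => div_le_of_le_mul₀ (Real.rpow_nonneg dist_nonneg _) hM (h p.1 p.2)) hM

theorem supNorm_le (f : LipAlgebra α X A) {C : ℝ} (hC : 0 ≤ C) (h : ∀ x, ‖f x‖ ≤ C) :
    f.supNorm ≤ C := Real.iSup_le h hC

variable (α X A) in
/-- The norm `‖f‖_∞ + p_α(f)`. -/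
noncomputable instance : Norm (LipAlgebra α X A) := ⟨fun f => f.supNorm + f.lipSeminorm⟩

theorem norm_def (f : LipAlgebra α X A) : ‖f‖ = f.supNorm + f.lipSeminorm := rfl

theorem quot_add_le (f g : LipAlgebra α X A) (p : X × X) :
    (f + g).quot p ≤ f.quot p + g.quot p := by
  rw [quot, quot, quot, ← add_div, add_apply, add_apply, add_sub_add_comm]
  exact div_le_div_of_nonneg_right (norm_add_le _ _) (Real.rpow_nonneg dist_nonneg _)

variable (α X A) in
theorem core : NormedSpace.Core ℂ (LipAlgebra α X A) where
  norm_nonneg f := add_nonneg f.supNorm_nonneg f.lipSeminorm_nonneg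
  norm_smul c f := by
    have h1 : (c • f).supNorm = ‖c‖ * f.supNorm := by
      simp only [supNorm, smul_apply, norm_smul]
      rw [Real.mul_iSup_of_nonneg (norm_nonneg _)]
    have h2 : (c • f).lipSeminorm = ‖c‖ * f.lipSeminorm := by
      simp only [lipSeminorm, quot, smul_apply, ← smul_sub, norm_smul, mul_div_assoc]
      rw [Real.mul_iSup_of_nonneg (norm_nonneg _)]
    rw [norm_def, norm_def, h1, h2, mul_add]
  norm_triangle f g := by
    have h1 : (f + g).supNorm ≤ f.supNorm + g.supNorm :=
      supNorm_le _ (add_nonneg f.supNorm_nonneg g.supNorm_nonneg) fun x =>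
        (norm_add_le _ _).trans
          (add_le_add (f.norm_apply_le_supNorm x) (g.norm_apply_le_supNorm x))
    have h2 : (f + g).lipSeminorm ≤ f.lipSeminorm + g.lipSeminorm :=
      Real.iSup_le (fun p => (quot_add_le f g p).trans
        (add_le_add (f.quot_le_lipSeminorm p) (g.quot_le_lipSeminorm p)))
        (add_nonneg f.lipSeminorm_nonneg g.lipSeminorm_nonneg)
    rw [norm_def, norm_def, norm_def]
    linarith
  norm_eq_zero_iff f := by
    constructor
    · intro h
      ext x
      have h1 := f.norm_apply_le_supNorm x
      have h2 := f.lipSeminorm_nonneg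
      rw [norm_def] at h
      exact norm_le_zero_iff.1 (by linarith)
    · rintro rfl
      simp [norm_def, supNorm, lipSeminorm, quot]

theorem norm_mul_le' (f g : LipAlgebra α X A) : ‖f * g‖ ≤ ‖f‖ * ‖g‖ := by
  have hf := f.supNorm_nonneg
  have hg := g.supNorm_nonneg
  have hf' := f.lipSeminorm_nonneg
  have hg' := g.lipSeminorm_nonneg
  have h1 : (f * g).supNorm ≤ f.supNorm * g.supNorm :=
    supNorm_le _ (mul_nonneg hf hg) fun x => (norm_mul_le _ _).trans
      (mul_le_mul (f.norm_apply_le_supNorm x) (g.norm_apply_le_supNorm x) (norm_nonneg _) hf)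
  have h2 : (f * g).lipSeminorm ≤ f.supNorm * g.lipSeminorm + f.lipSeminorm * g.supNorm := by
    refine lipSeminorm_le _ (by positivity) fun x y => ?_
    calc ‖(f * g) x - (f * g) y‖ = ‖f x * (g x - g y) + (f x - f y) * g y‖ := by
          rw [mul_apply, mul_apply, mul_sub, sub_mul, sub_add_sub_cancel]
      _ ≤ ‖f x‖ * ‖g x - g y‖ + ‖f x - f y‖ * ‖g y‖ :=
          (norm_add_le _ _).trans (add_le_add (norm_mul_le _ _) (norm_mul_le _ _))
      _ ≤ f.supNorm * (g.lipSeminorm * dist x y ^ α) +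
            (f.lipSeminorm * dist x y ^ α) * g.supNorm :=
          add_le_add
            (mul_le_mul (f.norm_apply_le_supNorm x) (g.norm_sub_le x y) (norm_nonneg _) hf)
            (mul_le_mul (f.norm_sub_le x y) (g.norm_apply_le_supNorm y) (norm_nonneg _)
              ((norm_nonneg _).trans (f.norm_sub_le x y)))
      _ = _ := by ring
  rw [norm_def, norm_def, norm_def]
  nlinarith [mul_nonneg hf' hg']

variable (α X A)

noncomputable instance : NonUnitalNormedRing (LipAlgebra α X A) where
  __ := NormedAddCommGroup.ofCore (core α X A)
  __ := (inferInstance : NonUnitalRing (LipAlgebra α X A))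
  norm_mul_le := norm_mul_le'

noncomputable instance : NormedSpace ℂ (LipAlgebra α X A) where
  norm_smul_le c f := ((core α X A).norm_smul c f).le

end LipAlgebra

/-- `lip_α(X, A)`: the subalgebra of those `f` in `Lip_α(X, A)` for which
`‖f x - f y‖ / d(x, y) ^ α` tends to `0` as `d(x, y) → 0`, with the norm of `Lip_α(X, A)`. -/
noncomputable def littleLip : NonUnitalSubalgebra ℂ (LipAlgebra α X A) where
  carrier := {f | ∀ ε > 0, ∃ δ > 0, ∀ x y, 0 < dist x y → dist x y < δ →
    ‖f x - f y‖ / dist x y ^ α < ε}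
  zero_mem' := fun ε hε => ⟨1, one_pos, fun x y _ _ => by simpa using hε⟩
  add_mem' := by
    intro f g hf hg ε hε
    obtain ⟨δ, hδ, h⟩ := hf (ε / 2) (half_pos hε)
    obtain ⟨δ', hδ', h'⟩ := hg (ε / 2) (half_pos hε)
    refine ⟨min δ δ', lt_min hδ hδ', fun x y h0 hxy => ?_⟩
    have h1 := h x y h0 (hxy.trans_le (min_le_left _ _))
    have h2 := h' x y h0 (hxy.trans_le (min_le_right _ _))
    calc _ ≤ _ := LipAlgebra.quot_add_le f g (x, y)
      _ < ε / 2 + ε / 2 := add_lt_add h1 h2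
      _ = ε := add_halves ε
  mul_mem' := by
    intro f g hf hg ε hε
    have hF := f.supNorm_nonneg
    have hG := g.supNorm_nonneg
    set K := f.supNorm + g.supNorm + 1 with hK
    have hK0 : 0 < K := by positivity
    obtain ⟨δ, hδ, h⟩ := hf (ε / K) (div_pos hε hK0)
    obtain ⟨δ', hδ', h'⟩ := hg (ε / K) (div_pos hε hK0)
    refine ⟨min δ δ', lt_min hδ hδ', fun x y h0 hxy => ?_⟩
    have hd : 0 < dist x y ^ α := Real.rpow_pos_of_pos h0 α
    have h1 := (div_lt_iff₀ hd).1 (h x y h0 (hxy.trans_le (min_le_left _ _)))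
    have h2 := (div_lt_iff₀ hd).1 (h' x y h0 (hxy.trans_le (min_le_right _ _)))
    have h3 : 0 < ε / K * dist x y ^ α := mul_pos (div_pos hε hK0) hd
    rw [div_lt_iff₀ hd]
    calc ‖(f * g) x - (f * g) y‖ = ‖f x * (g x - g y) + (f x - f y) * g y‖ := by
          rw [LipAlgebra.mul_apply, LipAlgebra.mul_apply, mul_sub, sub_mul, sub_add_sub_cancel]
      _ ≤ ‖f x‖ * ‖g x - g y‖ + ‖f x - f y‖ * ‖g y‖ :=
          (norm_add_le _ _).trans (add_le_add (norm_mul_le _ _) (norm_mul_le _ _))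
      _ ≤ f.supNorm * (ε / K * dist x y ^ α) + (ε / K * dist x y ^ α) * g.supNorm :=
          add_le_add
            (mul_le_mul (f.norm_apply_le_supNorm x) h2.le (norm_nonneg _) hF)
            (mul_le_mul h1.le (g.norm_apply_le_supNorm y) (norm_nonneg _) h3.le)
      _ < K * (ε / K * dist x y ^ α) := by rw [hK] at h3 ⊢; nlinarith
      _ = ε * dist x y ^ α := by field_simp
  smul_mem' := by
    intro c f hf ε hε
    obtain ⟨δ, hδ, h⟩ := hf (ε / (‖c‖ + 1)) (by positivity)
    refine ⟨δ, hδ, fun x y h0 hxy => ?_⟩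
    have h1 := (lt_div_iff₀ (by positivity)).1 (h x y h0 hxy)
    have h2 := f.quot_nonneg (x, y)
    rw [LipAlgebra.smul_apply, LipAlgebra.smul_apply, ← smul_sub, norm_smul, mul_div_assoc]
    simp only [LipAlgebra.quot] at h2
    nlinarith

noncomputable instance : NormedSpace ℂ (littleLip α X A) where
  norm_smul_le c f := norm_smul_le c (f : LipAlgebra α X A)

end Lipschitz

/-! ### Completeness: the normed algebras above are Banach algebras -/

section Complete

variable {α : ℝ} {X : Type v} [MetricSpace X] {A : Type u} [NonUnitalNormedRing A]
  [NormedSpace ℂ A]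

open Filter in
instance [CompleteSpace A] : CompleteSpace (LipAlgebra α X A) := by
  refine Metric.complete_of_cauchySeq_tendsto fun F hF => ?_
  have hpt : ∀ (f g : LipAlgebra α X A) x, dist (f x) (g x) ≤ dist f g := fun f g x => by
    rw [dist_eq_norm, dist_eq_norm, LipAlgebra.norm_def]
    exact ((f - g).norm_apply_le_supNorm x).trans
      (le_add_of_nonneg_right (f - g).lipSeminorm_nonneg)
  have hlim : ∀ x, ∃ a, Tendsto (fun n => F n x) atTop (𝓝 a) := fun x =>
    cauchySeq_tendsto_of_complete (Metric.cauchySeq_iff'.2 fun ε hε => by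
      obtain ⟨N, hN⟩ := Metric.cauchySeq_iff'.1 hF ε hε
      exact ⟨N, fun n hn => (hpt _ _ x).trans_lt (hN n hn)⟩)
  choose g hg using hlim
  have key : ∀ ε > 0, ∃ N, ∀ n ≥ N, (∀ x, ‖F n x - g x‖ ≤ ε) ∧
      ∀ x y, ‖(F n x - g x) - (F n y - g y)‖ ≤ ε * dist x y ^ α := by
    intro ε hε
    obtain ⟨N, hN⟩ := Metric.cauchySeq_iff.1 hF ε hε
    refine ⟨N, fun n hn => ⟨fun x => ?_, fun x y => ?_⟩⟩
    · refine le_of_tendsto ((tendsto_const_nhds.sub (hg x)).norm) ?_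
      filter_upwards [eventually_ge_atTop N] with m hm
      rw [← dist_eq_norm]
      exact (hpt _ _ x).trans (hN n hn m hm).le
    · refine le_of_tendsto
        (((tendsto_const_nhds.sub (hg x)).sub (tendsto_const_nhds.sub (hg y))).norm) ?_
      filter_upwards [eventually_ge_atTop N] with m hm
      refine ((F n - F m).norm_sub_le x y).trans
        (mul_le_mul_of_nonneg_right ?_ (Real.rpow_nonneg dist_nonneg _))
      have := (hN n hn m hm).le
      rw [dist_eq_norm, LipAlgebra.norm_def] at this
      exact (le_add_of_nonneg_left (F n - F m).supNorm_nonneg).trans this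
  obtain ⟨N, hN⟩ := key 1 one_pos
  obtain ⟨hN1, hN2⟩ := hN N le_rfl
  have hmem : (fun x => F N x - g x) ∈ lipschitzFunctions α X A := ⟨⟨1, hN1⟩, ⟨1, hN2⟩⟩
  let G : LipAlgebra α X A := F N - ⟨_, hmem⟩
  have hG : ∀ x, G x = g x := fun x => sub_sub_cancel (F N x) (g x)
  refine ⟨G, Metric.tendsto_atTop.2 fun ε hε => ?_⟩
  obtain ⟨N', hN'⟩ := key (ε / 3) (by positivity)
  refine ⟨N', fun n hn => ?_⟩
  obtain ⟨h1, h2⟩ := hN' n hn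
  have e1 : (F n - G).supNorm ≤ ε / 3 :=
    LipAlgebra.supNorm_le _ (by positivity) fun x => by
      rw [LipAlgebra.sub_apply, hG]; exact h1 x
  have e2 : (F n - G).lipSeminorm ≤ ε / 3 :=
    LipAlgebra.lipSeminorm_le _ (by positivity) fun x y => by
      rw [LipAlgebra.sub_apply, LipAlgebra.sub_apply, hG, hG]; exact h2 x y
  rw [dist_eq_norm, LipAlgebra.norm_def]
  linarith

instance [CompleteSpace A] : CompleteSpace (littleLip α X A) := by
  suffices h : IsClosed (littleLip α X A : Set (LipAlgebra α X A)) from h.completeSpace_coe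
  refine isClosed_of_closure_subset fun f hf ε hε => ?_
  obtain ⟨g, hg, hfg⟩ := Metric.mem_closure_iff.1 hf (ε / 2) (half_pos hε)
  obtain ⟨δ, hδ, h⟩ := hg (ε / 2) (half_pos hε)
  refine ⟨δ, hδ, fun x y h0 hxy => ?_⟩
  have h1 := LipAlgebra.quot_add_le (f - g) g (x, y)
  rw [sub_add_cancel] at h1
  have h2 := (f - g).quot_le_lipSeminorm (x, y)
  rw [dist_eq_norm, LipAlgebra.norm_def] at hfg
  have h3 := (f - g).supNorm_nonneg
  have h4 := h x y h0 hxy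
  simp only [LipAlgebra.quot] at h1 h2
  linarith

end Complete

-- Everything reduces to a Banach algebra `B` of `A`-valued functions on `X` with contractive
-- evaluations and enough functions `g a` with `g` scalar (`contractible_functionAlgebra_iff`).
--
-- Finiteness of `X`: with `φ` a character of `A`, the maps `φ ∘ ev x` are distinct multiplicative
-- functionals of norm at most `‖φ‖`, and a contractible algebra has no infinite bounded family of
-- these (`IsContractibleAlgebra.finite_of_characters`). Indeed, such a family gives a homomorphism
-- `Φ` into `ℓ^∞(I)`; let `L` be the limit along a free ultrafilter. The derivation `a ↦ Φ a - L (Φ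
-- a)` takes values in `ker L`, so it is implemented by some `z` with `L z = 0`. The defining
-- identity forces `z i = -1` for all but at most one `i`, hence `L z = -1`, a contradiction.
--
-- Contractibility of `A`: evaluation at a point is a surjective homomorphism, split linearly by the
-- constant functions.
--
-- Converse: for finite `X` the indicator functions of points make `B` a finite orthogonal sum of
-- copies of `A`, and inner implementations on the summands can be glued
-- (`IsContractibleAlgebra.of_orthogonal_sum`).
--
-- All three arguments survive passing to second adjoints. Functionals on `B` act on `B**` by
-- evaluation, multiplicatively for the Arens product if they are multiplicative on `B`; right
-- inverses and finite decompositions are preserved.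

universe w

/-! ### Factoring bounded maps through isometries -/

/-- A bounded linear map whose range lies in the range of a linear isometry factors through it. -/
theorem LinearIsometry.exists_lift {B E F : Type*} [SeminormedAddCommGroup B] [NormedSpace ℂ B]
    [NormedAddCommGroup E] [NormedSpace ℂ E] [NormedAddCommGroup F] [NormedSpace ℂ F]
    (ι : F →ₗᵢ[ℂ] E) (T : B →L[ℂ] E) (h : ∀ b, ∃ y, ι y = T b) :
    ∃ S : B →L[ℂ] F, ∀ b, ι (S b) = T b := by
  choose S hS using h
  refine ⟨LinearMap.mkContinuous
    { toFun := S
      map_add' := fun a b => ι.injective (by simp [hS])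
      map_smul' := fun c b => ι.injective (by simp [hS]) } ‖T‖ fun b => ?_, hS⟩
  change ‖S b‖ ≤ _
  rw [← ι.norm_map, hS]
  exact T.le_opNorm b

/-- A bounded bilinear map whose range lies in the range of a linear isometry factors through
it. -/
theorem LinearIsometry.exists_lift₂ {B G E F : Type*} [SeminormedAddCommGroup B]
    [NormedSpace ℂ B] [SeminormedAddCommGroup G] [NormedSpace ℂ G]
    [NormedAddCommGroup E] [NormedSpace ℂ E] [NormedAddCommGroup F] [NormedSpace ℂ F]
    (ι : F →ₗᵢ[ℂ] E) (T : B →L[ℂ] G →L[ℂ] E) (h : ∀ b x, ∃ y, ι y = T b x) :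
    ∃ S : B →L[ℂ] G →L[ℂ] F, ∀ b x, ι (S b x) = T b x := by
  choose S hS using h
  refine ⟨LinearMap.mkContinuous₂ (LinearMap.mk₂ ℂ S
    (fun a b x => ι.injective (by simp [hS])) (fun c a x => ι.injective (by simp [hS]))
    (fun a x y => ι.injective (by simp [hS])) (fun c a x => ι.injective (by simp [hS])))
    ‖T‖ fun b x => ?_, hS⟩
  change ‖S b x‖ ≤ _
  rw [← ι.norm_map, hS]
  exact T.le_opNorm₂ b x

/-! ### Contractibility: sub-bimodules, universes, images, identity -/

section Contractible

variable {A : Type u} [NonUnitalNormedRing A] [NormedSpace ℂ A]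

/-- If every derivation into `F` is inner, then so is a derivation into a bimodule that contains
`F` isometrically as a sub-bimodule, provided that its values lie in `F`. -/
theorem BanachBimodule.exists_of_isometry {E F : Type*} [NormedAddCommGroup E] [NormedSpace ℂ E]
    [NormedAddCommGroup F] [NormedSpace ℂ F]
    (hF : ∀ (M : BanachBimodule A F) (D : A →L[ℂ] F), M.IsDerivation D → M.IsInner D)
    (M : BanachBimodule A E) (D : A →L[ℂ] E)
    (hD : M.IsDerivation D) (ι : F →ₗᵢ[ℂ] E) (hl : ∀ a x, ∃ y, ι y = M.lact a (ι x))
    (hr : ∀ a x, ∃ y, ι y = M.ract a (ι x)) (hι : ∀ a, ∃ y, ι y = D a) :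
    ∃ z : F, ∀ a, D a = M.ract a (ι z) - M.lact a (ι z) := by
  -- Restriction of operators on `E` to `F` along `ι`; the restricted actions are then lifted back
  -- into `F`.
  let pre : (E →L[ℂ] E) →L[ℂ] F →L[ℂ] E :=
    (ContinuousLinearMap.compL ℂ F E E).flip ι.toContinuousLinearMap
  obtain ⟨L, hL⟩ := ι.exists_lift₂ (pre.comp M.lact) hl
  obtain ⟨R, hR⟩ := ι.exists_lift₂ (pre.comp M.ract) hr
  obtain ⟨D', hD'⟩ := ι.exists_lift D hι
  replace hL : ∀ a x, ι (L a x) = M.lact a (ι x) := hL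
  replace hR : ∀ a x, ι (R a x) = M.ract a (ι x) := hR
  obtain ⟨z, hz⟩ := hF ⟨L, R, fun a b x => ι.injective (by simp [hL, M.lact_mul]),
    fun a b x => ι.injective (by simp [hR, M.ract_mul]),
    fun a b x => ι.injective (by simp [hL, hR, M.lact_ract])⟩ D'
    (fun a b => ι.injective (by simp [hL, hR, hD', hD a b]))
  refine ⟨z, fun a => ?_⟩
  rw [← hD', hz a, map_sub, hL, hR]

/-- In a metric space each point of the closure is the limit of a sequence from `S`, so the closure
injects into `ℕ → S`. -/
theorem Submodule.small_topologicalClosure {E : Type w} [NormedAddCommGroup E] [NormedSpace ℂ E]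
    (S : Submodule ℂ E) [Small.{u} S] : Small.{u} S.topologicalClosure := by
  have h : ∀ x : S.topologicalClosure, ∃ s : ℕ → S,
      Filter.Tendsto (fun n => (s n : E)) Filter.atTop (𝓝 (x : E)) := by
    intro x
    obtain ⟨s, hs, hx⟩ := mem_closure_iff_seq_limit.1 x.2
    exact ⟨fun n => ⟨s n, hs n⟩, hx⟩
  choose s hs using h
  refine small_of_injective (f := s) fun x y hxy => Subtype.ext ?_
  exact tendsto_nhds_unique (hs x) (hxy ▸ hs y)

/-- Contractibility does not depend on the universe of the bimodules. -/
theorem IsContractibleAlgebra.isInner (hA : IsContractibleAlgebra A) {E : Type w}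
    [NormedAddCommGroup E] [NormedSpace ℂ E] [CompleteSpace E] (M : BanachBimodule A E)
    (D : A →L[ℂ] E) (hD : M.IsDerivation D) : M.IsInner D := by
  -- The closed span of all `D a` and `D a · b` is a sub-bimodule containing the range of `D`. Its
  -- span is parametrized by finitely supported functions on a type in `Type u`, so the closure can
  -- be replaced by an isometric copy in `Type u`.
  let g : A ⊕ A × A → E := Sum.elim D fun p => M.ract p.2 (D p.1)
  let S : Submodule ℂ E := LinearMap.range (Finsupp.linearCombination ℂ g)
  have hg : ∀ i, g i ∈ S := fun i => ⟨Finsupp.single i 1, by simp⟩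
  have hDS : ∀ a, D a ∈ S := fun a => hg (Sum.inl a)
  have hDR : ∀ a b, M.ract b (D a) ∈ S := fun a b => hg (Sum.inr (a, b))
  have hS : ∀ T : E →L[ℂ] E, (∀ i, T (g i) ∈ S) → ∀ x ∈ S.topologicalClosure,
      T x ∈ S.topologicalClosure := by
    intro T hT x hx
    refine map_mem_closure T.continuous hx ?_
    rintro _ ⟨c, rfl⟩
    rw [Finsupp.linearCombination_apply, Finsupp.sum, map_sum]
    refine S.sum_mem fun i _ => ?_
    rw [map_smul]
    exact S.smul_mem _ (hT i)
  -- No generators `a · D b` are needed: `a · D b = D (a b) - D a · b`, and therefore `a · (D b · c)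
  -- = D (a b) · c - D a · (b c)`.
  have hl : ∀ a, ∀ x ∈ S.topologicalClosure, M.lact a x ∈ S.topologicalClosure := by
    have h : ∀ a b, M.lact a (D b) ∈ S := fun a b => by
      rw [← add_sub_cancel_left (M.ract b (D a)) (M.lact a (D b)), ← hD a b]
      exact S.sub_mem (hDS _) (hDR _ _)
    refine fun a => hS _ ?_
    rintro (b | ⟨b, c⟩)
    · exact h a b
    · change M.lact a (M.ract c (D b)) ∈ S
      rw [M.lact_ract, ← add_sub_cancel_left (M.ract b (D a)) (M.lact a (D b)), ← hD a b, map_sub,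
        ← M.ract_mul]
      exact S.sub_mem (hDR _ _) (hDR _ _)
  have hr : ∀ a, ∀ x ∈ S.topologicalClosure, M.ract a x ∈ S.topologicalClosure := by
    refine fun a => hS _ ?_
    rintro (b | ⟨b, c⟩)
    · exact hDR b a
    · change M.ract a (M.ract c (D b)) ∈ S
      rw [← M.ract_mul]
      exact hDR _ _
  have : Small.{u} S.topologicalClosure := by
    have : Small.{u} S := small_range _
    exact S.small_topologicalClosure
  have : CompleteSpace S.topologicalClosure := S.isClosed_topologicalClosure.completeSpace_coe
  let e : Shrink.{u} S.topologicalClosure ≃ₗᵢ[ℂ] S.topologicalClosure :=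
    { Shrink.linearEquiv ℂ S.topologicalClosure with norm_map' := fun _ => rfl }
  have : CompleteSpace (Shrink.{u} S.topologicalClosure) :=
    e.toIsometryEquiv.completeSpace
  let ι : Shrink.{u} S.topologicalClosure →ₗᵢ[ℂ] E :=
    S.topologicalClosure.subtypeₗᵢ.comp e.toLinearIsometry
  have hι : ∀ x ∈ S.topologicalClosure, ∃ y, ι y = x := fun x hx => ⟨e.symm ⟨x, hx⟩, by
    simp [ι]⟩
  have hι' : ∀ y, ι y ∈ S.topologicalClosure := fun y => (e y).2
  obtain ⟨z, hz⟩ := M.exists_of_isometry (hA _) D hD ι (fun a x => hι _ (hl a _ (hι' x)))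
    (fun a x => hι _ (hr a _ (hι' x))) (fun a => hι _ (S.le_topologicalClosure (hDS a)))
  exact ⟨ι z, hz⟩

/-- The bimodule over `B` obtained from a bimodule over `A` along a homomorphism `B → A`. -/
noncomputable def BanachBimodule.pullback {B : Type*} [NonUnitalNormedRing B] [NormedSpace ℂ B]
    {E : Type*} [NormedAddCommGroup E] [NormedSpace ℂ E] (M : BanachBimodule A E) (T : B →L[ℂ] A)
    (hT : ∀ a b, T (a * b) = T a * T b) : BanachBimodule B E where
  lact := M.lact.comp T
  ract := M.ract.comp T
  lact_mul a b x := by simp [hT, M.lact_mul]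
  ract_mul a b x := by simp [hT, M.ract_mul]
  lact_ract a b x := by simp [M.lact_ract]

/-- Contractibility passes to the image under a continuous surjective homomorphism. -/
theorem IsContractibleAlgebra.of_surjective {B : Type w} [NonUnitalNormedRing B]
    [NormedSpace ℂ B] (hB : IsContractibleAlgebra B) (T : B →L[ℂ] A)
    (hT : ∀ a b, T (a * b) = T a * T b) (hs : Function.Surjective T) :
    IsContractibleAlgebra A := by
  intro E _ _ _ M D hD
  obtain ⟨z, hz⟩ := hB.isInner (M.pullback T hT) (D.comp T) fun a b => by
    simpa [BanachBimodule.pullback, hT] using hD (T a) (T b)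
  refine ⟨z, fun a => ?_⟩
  obtain ⟨b, rfl⟩ := hs a
  exact hz b

/-- A contractible Banach algebra has an identity. -/
theorem IsContractibleAlgebra.exists_one [IsScalarTower ℂ A A] [SMulCommClass ℂ A A]
    [CompleteSpace A] (hA : IsContractibleAlgebra A) : ∃ e : A, ∀ a, e * a = a ∧ a * e = a := by
  -- With one of the two actions equal to zero, the identity map of `A` is a derivation.
  -- Implementing it gives a right identity `-r`, and in the mirrored case a left identity `l`; the
  -- two coincide.
  obtain ⟨r, hr⟩ := hA A ⟨ContinuousLinearMap.mul ℂ A, 0, fun a b x => mul_assoc a b x,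
    fun _ _ _ => by simp, fun _ _ _ => by simp⟩ (ContinuousLinearMap.id ℂ A) fun a b => by simp
  obtain ⟨l, hl⟩ := hA A ⟨0, (ContinuousLinearMap.mul ℂ A).flip, fun _ _ _ => by simp,
    fun a b x => (mul_assoc x a b).symm, fun _ _ _ => by simp⟩ (ContinuousLinearMap.id ℂ A)
    fun a b => by simp
  have h1 : ∀ a, a = a * -r := fun a => by simpa using hr a
  have h2 : ∀ a, a = l * a := fun a => by simpa using hl a
  have h3 : l = -r := (h1 l).trans (h2 (-r)).symm
  exact ⟨l, fun a => ⟨(h2 a).symm, by rw [h3]; exact (h1 a).symm⟩⟩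

end Contractible

/-! ### Bounded families of characters on a contractible algebra -/

open scoped ENNReal in
/-- The limit of a bounded family along an ultrafilter. -/
theorem Ultrafilter.exists_lim_lp {I : Type*} (U : Ultrafilter I) :
    ∃ L : lp (fun _ : I => ℂ) ∞ →L[ℂ] ℂ,
      ∀ h : lp (fun _ : I => ℂ) ∞, Filter.Tendsto (fun i => h i) U (𝓝 (L h)) := by
  have h1 : ∀ h : lp (fun _ : I => ℂ) ∞, ∃ c, ‖c‖ ≤ ‖h‖ ∧
      Filter.Tendsto (fun i => h i) U (𝓝 c) := by
    intro h
    obtain ⟨c, hc, hc'⟩ := (isCompact_closedBall (0 : ℂ) ‖h‖).ultrafilter_le_nhds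
      (U.map fun i => h i) (by
        rw [Filter.le_principal_iff]
        exact Filter.mem_map.2 (Filter.univ_mem' fun i =>
          mem_closedBall_zero_iff.2 (lp.norm_apply_le_norm ENNReal.top_ne_zero h i)))
    exact ⟨c, by simpa using hc, hc'⟩
  choose L hL hL' using h1
  exact ⟨LinearMap.mkContinuous
    { toFun := L
      map_add' := fun f g => tendsto_nhds_unique (hL' _) ((hL' f).add (hL' g))
      map_smul' := fun c f => tendsto_nhds_unique (hL' _) ((hL' f).const_smul c) } 1
    fun h => by simpa using hL h, hL'⟩

/-- A contractible Banach algebra acts on a commutative Banach algebra `V` through a homomorphism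
`Φ` on the left and through `L ∘ Φ`, for a character `L` of `V`, on the right; the derivation
`a ↦ Φ a - L (Φ a)` is implemented by an element of the kernel of `L`. -/
theorem IsContractibleAlgebra.exists_mem_ker {B : Type u} [NonUnitalNormedRing B]
    [NormedSpace ℂ B] (hB : IsContractibleAlgebra B) {V : Type v} [NormedCommRing V]
    [NormedAlgebra ℂ V] [CompleteSpace V] (Φ : B →L[ℂ] V) (hΦ : ∀ a b, Φ (a * b) = Φ a * Φ b)
    (L : V →L[ℂ] ℂ) (hLm : ∀ f g, L (f * g) = L f * L g) (hL1 : L 1 = 1) :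
    ∃ z : V, L z = 0 ∧ ∀ a, Φ a - L (Φ a) • 1 = L (Φ a) • z - Φ a * z := by
  -- In `V` this derivation is implemented by `-1`, which is not in `ker L`. The content is that,
  -- since `D` maps into the sub-bimodule `ker L`, there must also be an implementing element inside
  -- it.
  let M : BanachBimodule B V :=
    { lact := (ContinuousLinearMap.mul ℂ V).comp Φ
      ract := (ContinuousLinearMap.lsmul ℂ ℂ).comp (L.comp Φ)
      lact_mul := fun a b x => by simp [hΦ, mul_assoc]
      ract_mul := fun a b x => by simp [hΦ, hLm, smul_smul]
      lact_ract := fun a b x => by simp }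
  let D : B →L[ℂ] V := Φ - (L.comp Φ).smulRight 1
  have hMl : ∀ a x, M.lact a x = Φ a * x := fun _ _ => rfl
  have hMr : ∀ a x, M.ract a x = L (Φ a) • x := fun _ _ => rfl
  have hDa : ∀ a, D a = Φ a - L (Φ a) • 1 := fun _ => rfl
  have hker : ∀ x : V, L x = 0 →
      ∃ y : LinearMap.ker L.toLinearMap, (LinearMap.ker L.toLinearMap).subtypeₗᵢ y = x :=
    fun x hx => ⟨⟨x, hx⟩, rfl⟩
  have : CompleteSpace (LinearMap.ker L.toLinearMap) := L.isClosed_ker.completeSpace_coe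
  have hx : ∀ x : LinearMap.ker L.toLinearMap, L x = 0 := fun x => x.2
  obtain ⟨z, hz⟩ := M.exists_of_isometry (fun N => hB.isInner N) D (fun a b => by
      rw [hMl, hMr, hDa, hDa, hDa, hΦ, hLm, mul_sub, smul_sub, smul_smul, mul_smul_comm, mul_one,
        mul_comm (L (Φ b))]
      abel) (LinearMap.ker L.toLinearMap).subtypeₗᵢ
    (fun a x => hker _ (by
      rw [hMl, hLm, Submodule.coe_subtypeₗᵢ, Submodule.subtype_apply, hx, mul_zero]))
    (fun a x => hker _ (by
      rw [hMr, map_smul, Submodule.coe_subtypeₗᵢ, Submodule.subtype_apply, hx, smul_zero]))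
    (fun a => hker _ (by rw [hDa, map_sub, map_smul, hL1, smul_eq_mul, mul_one, sub_self]))
  exact ⟨z, hx z, hz⟩

open scoped ENNReal in
/-- A contractible Banach algebra has no infinite bounded set of characters. -/
theorem IsContractibleAlgebra.finite_of_characters {B : Type u} [NonUnitalNormedRing B]
    [NormedSpace ℂ B] (hB : IsContractibleAlgebra B) {I : Type v} (χ : I → B →L[ℂ] ℂ)
    (hmul : ∀ i a b, χ i (a * b) = χ i a * χ i b) {C : ℝ} (hC : ∀ i, ‖χ i‖ ≤ C)
    (hinj : ∀ i j, (∀ a, χ i a = χ j a) → i = j) : Finite I := by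
  by_contra hI
  rw [not_finite_iff_infinite] at hI
  obtain ⟨L, hL⟩ := (Filter.hyperfilter I).exists_lim_lp
  have hbd : ∀ a i, ‖χ i a‖ ≤ C * ‖a‖ := fun a i =>
    ((χ i).le_opNorm a).trans (mul_le_mul_of_nonneg_right (hC i) (norm_nonneg a))
  have hC0 : 0 ≤ C := (norm_nonneg _).trans (hC hI.nonempty.some)
  let Φ : B →L[ℂ] lp (fun _ : I => ℂ) ∞ := LinearMap.mkContinuous
    { toFun := fun a => ⟨fun i => χ i a, memℓp_infty ⟨C * ‖a‖, by
        rintro _ ⟨i, rfl⟩; exact hbd a i⟩⟩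
      map_add' := fun a b => lp.ext (funext fun i => map_add (χ i) a b)
      map_smul' := fun c a => lp.ext (funext fun i => map_smul (χ i) c a) } C
    fun a => lp.norm_le_of_forall_le (mul_nonneg hC0 (norm_nonneg a)) (hbd a)
  have hΦ : ∀ a i, Φ a i = χ i a := fun _ _ => rfl
  have hΦm : ∀ a b, Φ (a * b) = Φ a * Φ b := fun a b => lp.ext (funext fun i => by
    rw [lp.infty_coeFn_mul, Pi.mul_apply, hΦ, hΦ, hΦ, hmul])
  have hLm : ∀ f g, L (f * g) = L f * L g := fun f g =>
    tendsto_nhds_unique (hL _) (by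
      rw [lp.infty_coeFn_mul]
      exact (hL f).mul (hL g))
  have hL1 : L 1 = 1 := tendsto_nhds_unique (hL 1) (by
    rw [lp.infty_coeFn_one]
    exact tendsto_const_nhds)
  obtain ⟨z, hLz, hz⟩ := hB.exists_mem_ker Φ hΦm L hLm hL1
  have hz0 : Filter.Tendsto (fun i => z i) (Filter.hyperfilter I)
      (𝓝 0) := by
    have h := hL z
    rwa [hLz] at h
  -- Coordinate `i` of the identity for `z` reads `(χ i a - L (Φ a)) * (1 + z i) = 0`.
  have hz1 : ∀ i, (∃ a, χ i a ≠ L (Φ a)) → z i = -1 := by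
    rintro i ⟨a, ha⟩
    have h : χ i a - L (Φ a) * 1 = L (Φ a) * z i -
        χ i a * z i :=
      congrArg (fun f : lp (fun _ : I => ℂ) ∞ => f i) (hz a)
    exact mul_left_cancel₀ (sub_ne_zero.2 ha) (by linear_combination h)
  -- The exceptional indices are those with `χ i = L ∘ Φ`; by injectivity there is at most one, and
  -- a free ultrafilter ignores it.
  have hfin : {i | ¬ ∃ a, χ i a ≠ L (Φ a)}.Finite := by
    refine Set.Subsingleton.finite fun i hi j hj => hinj i j fun a => ?_
    simp only [Set.mem_ofPred_eq, not_exists, not_not] at hi hj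
    rw [hi, hj]
  have hev : ∀ᶠ i in Filter.hyperfilter I, (-1 : ℂ) = z i := by
    filter_upwards [Filter.compl_mem_hyperfilter_of_finite hfin] with i hi
    exact (hz1 i (not_not.1 hi)).symm
  have h := tendsto_nhds_unique (hz0.congr' (hev.mono fun _ h => h.symm)) tendsto_const_nhds
  norm_num at h

/-! ### Finite orthogonal sums of contractible algebras -/

/-- An algebra that is a finite orthogonal sum of images of a contractible algebra is
contractible. -/
theorem IsContractibleAlgebra.of_orthogonal_sum {A : Type u} [NonUnitalNormedRing A]
    [NormedSpace ℂ A] [IsScalarTower ℂ A A] [SMulCommClass ℂ A A] [CompleteSpace A]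
    (hA : IsContractibleAlgebra A) {B : Type w} [NonUnitalNormedRing B] [NormedSpace ℂ B]
    {I : Type v} [Fintype I] (ι : I → A →L[ℂ] B) (π : I → B → A)
    (hmul : ∀ i a b, ι i (a * b) = ι i a * ι i b)
    (horth : ∀ i j, i ≠ j → ∀ a b, ι i a * ι j b = 0)
    (hsum : ∀ b, ∑ i, ι i (π i b) = b) : IsContractibleAlgebra B := by
  classical
  intro E _ _ _ M D hD
  obtain ⟨one, hone⟩ := hA.exists_one
  set e : I → B := fun i => ι i one with he
  set u : B := ∑ i, e i with hu
  have he1 : ∀ i a, e i * ι i a = ι i a := fun i a => by rw [he, ← hmul, (hone a).1]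
  have he2 : ∀ i a, ι i a * e i = ι i a := fun i a => by rw [he, ← hmul, (hone a).2]
  have hue : ∀ i, u * e i = e i := fun i => by
    rw [hu, Finset.sum_mul, Finset.sum_eq_single i (fun j _ hj => horth j i hj _ _) (by simp)]
    exact he1 i one
  have heu : ∀ i, e i * u = e i := fun i => by
    rw [hu, Finset.mul_sum, Finset.sum_eq_single i (fun j _ hj => horth i j hj.symm _ _)
      (by simp)]
    exact he1 i one
  have huu : u * u = u := by
    conv_lhs => rw [hu, Finset.sum_mul]
    exact Finset.sum_congr rfl fun i _ => heu i
  -- Apply `u ·` to `D (u u) = D u · u + u · D u`. Bimodules are not assumed unital, so `D u` itself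
  -- need not vanish.
  have huD : M.ract u (M.lact u (D u)) = 0 := by
    have h1 := congrArg (M.lact u) (hD u u)
    rw [huu, map_add, ← M.lact_mul, huu, M.lact_ract] at h1
    simpa using h1
  have huDe : ∀ i, M.ract (e i) (M.lact u (D u)) = 0 := fun i => by
    rw [← hue, M.ract_mul, huD, map_zero]
  -- an element implementing the derivation on the idempotents `e i`
  set z₀ : E := ∑ j, M.ract (e j) (D (e j)) - M.lact u (D u) with hz₀
  have hz₀e : ∀ i, D (e i) = M.ract (e i) z₀ - M.lact (e i) z₀ := by
    intro i
    have h1 : M.ract (e i) (∑ j, M.ract (e j) (D (e j))) = M.ract (e i) (D (e i)) := by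
      rw [map_sum, Finset.sum_eq_single i (fun j _ hj => by
        rw [← M.ract_mul, horth j i hj]; simp) (by simp), ← M.ract_mul, he1]
    have h2 : M.lact (e i) (∑ j, M.ract (e j) (D (e j))) =
        M.ract (e i) (D (e i)) - M.ract u (D (e i)) := by
      have h : ∀ j, M.lact (e i) (M.ract (e j) (D (e j))) =
          M.ract (e j) (D (e i * e j)) - M.ract (e j) (D (e i)) := fun j => by
        rw [hD, map_add, ← M.ract_mul, he1, M.lact_ract]
        abel
      rw [map_sum, Finset.sum_congr rfl fun j _ => h j, Finset.sum_sub_distrib,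
        Finset.sum_eq_single i (fun j _ hj => by rw [horth i j hj.symm]; simp) (by simp), he1,
        hu, map_sum, _root_.sum_apply]
    have h3 : D (e i) = M.ract u (D (e i)) + M.lact (e i) (D u) := by
      rw [← hD, heu]
    rw [hz₀, map_sub, map_sub, h1, h2, huDe, ← M.lact_mul, heu]
    conv_lhs => rw [h3]
    abel
  clear_value z₀
  clear hz₀
  set D' : B →L[ℂ] E := D - (M.ract.flip z₀ - M.lact.flip z₀) with hD'
  have hD'a : ∀ a, D' a = D a - (M.ract a z₀ - M.lact a z₀) := fun _ => rfl
  have hD'd : M.IsDerivation D' := fun a b => by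
    rw [hD'a, hD'a, hD'a, hD, M.ract_mul, M.lact_mul, map_sub, map_sub, map_sub, map_sub,
      M.lact_ract]
    abel
  have hD'e : ∀ i, D' (e i) = 0 := fun i => by rw [hD'a, ← hz₀e, sub_self]
  -- As `D'` kills `e i`, its values on the `i`-th summand lie in the corner `e i · E · e i`.
  have hcut : ∀ i a, D' (ι i a) = M.lact (e i) (M.ract (e i) (D' (ι i a))) := by
    intro i a
    have h1 : D' (ι i a) = M.ract (e i) (D' (ι i a)) := by
      conv_lhs => rw [← he2, hD'd, hD'e, map_zero, add_zero]
    rw [← h1]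
    conv_lhs => rw [← he1, hD'd, hD'e, map_zero, zero_add]
  have hloc : ∀ i, ∃ z : E, ∀ a, D' (ι i a) = M.ract (ι i a) z - M.lact (ι i a) z := by
    intro i
    exact hA.isInner (M.pullback (ι i) (hmul i)) (D'.comp (ι i)) fun a b => by
      simpa [BanachBimodule.pullback, hmul] using hD'd (ι i a) (ι i b)
  choose z hz using hloc
  -- Compressing each `z i` to its own corner keeps it from interfering with the other summands, so
  -- one element serves for all of them.
  set w : E := ∑ i, M.lact (e i) (M.ract (e i) (z i)) with hw
  have hwr : ∀ i a, M.ract (ι i a) w = M.lact (e i) (M.ract (ι i a) (z i)) := fun i a => by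
    rw [hw, map_sum, Finset.sum_eq_single i (fun j _ hj => by
      rw [← M.lact_ract, ← M.ract_mul, horth j i hj]; simp) (by simp), ← M.lact_ract,
      ← M.ract_mul, he1]
  have hwl : ∀ i a, M.lact (ι i a) w = M.ract (e i) (M.lact (ι i a) (z i)) := fun i a => by
    rw [hw, map_sum, Finset.sum_eq_single i (fun j _ hj => by
      rw [← M.lact_mul, horth i j hj.symm]; simp) (by simp), ← M.lact_mul, he2, M.lact_ract]
  have hD'w : ∀ i a, D' (ι i a) = M.ract (ι i a) w - M.lact (ι i a) w := fun i a => by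
    rw [hwr, hwl, hcut, hz, map_sub, map_sub, ← M.ract_mul, he2, M.lact_ract (e i) (e i),
      ← M.lact_mul, he1]
  refine ⟨z₀ + w, fun b => ?_⟩
  have h : D' b = M.ract b w - M.lact b w := by
    rw [← hsum b]
    simp only [map_sum, hD'w, _root_.sum_apply, Finset.sum_sub_distrib]
  rw [map_add, map_add, add_sub_add_comm, ← h, hD'a]
  abel

/-! ### Second adjoints and the first Arens product -/

section BidualMap

variable {A : Type u} [NonUnitalNormedRing A] [NormedSpace ℂ A]
  {B : Type w} [NonUnitalNormedRing B] [NormedSpace ℂ B]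

/-- The second adjoint of a bounded linear map. -/
noncomputable def Bidual.map (T : A →L[ℂ] B) : Bidual A →L[ℂ] Bidual B :=
  (ContinuousLinearMap.compL ℂ (StrongDual ℂ B) (StrongDual ℂ A) ℂ).flip
    ((ContinuousLinearMap.compL ℂ A B ℂ).flip T)

theorem Bidual.map_apply (T : A →L[ℂ] B) (m : Bidual A) (f : StrongDual ℂ B) :
    Bidual.map T m f = m (f.comp T) := rfl

theorem Bidual.map_map_of_leftInverse {T : A →L[ℂ] B} {S : B →L[ℂ] A}
    (h : ∀ b, T (S b) = b) (m : Bidual B) : Bidual.map T (Bidual.map S m) = m := by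
  ext f
  rw [Bidual.map_apply, Bidual.map_apply]
  congr 1
  ext b
  simp [h]

theorem Bidual.sum_apply {I : Type*} (s : Finset I) (m : I → Bidual A) (f : StrongDual ℂ A) :
    (∑ i ∈ s, m i) f = ∑ i ∈ s, m i f :=
  _root_.sum_apply (F := StrongDual ℂ (StrongDual ℂ A)) s m f

/-- This carries a finite decomposition of the identity of `B` over to `B**`: for a functional `f`
on `B`, the functionals `f ∘ T i ∘ S i` sum to `f`. -/
theorem Bidual.sum_map_map {I : Type*} [Fintype I] {T : I → A →L[ℂ] B} {S : I → B →L[ℂ] A}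
    (h : ∀ b, ∑ i, T i (S i b) = b) (m : Bidual B) :
    ∑ i, Bidual.map (T i) (Bidual.map (S i) m) = m := by
  ext f
  rw [Bidual.sum_apply]
  simp only [Bidual.map_apply]
  rw [← map_sum]
  congr 1
  ext b
  rw [_root_.sum_apply]
  conv_rhs => rw [← h b, map_sum]
  rfl

/-- Evaluation at a functional on `A`, as a functional on `A**`. -/
noncomputable def Bidual.eval (f : StrongDual ℂ A) : Bidual A →L[ℂ] ℂ :=
  ContinuousLinearMap.apply ℂ ℂ f

theorem Bidual.eval_apply (f : StrongDual ℂ A) (m : Bidual A) : Bidual.eval f m = m f := rfl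

variable [IsScalarTower ℂ B B] [SMulCommClass ℂ B B]

theorem Bidual.map_mul_map_eq_zero {T S : A →L[ℂ] B} (h : ∀ a b, T a * S b = 0)
    (m n : Bidual A) : Bidual.map T m * Bidual.map S n = 0 := by
  ext f
  rw [Bidual.mul_apply, Bidual.map_apply, Bidual.zero_apply]
  refine (congrArg m ?_).trans (map_zero m)
  ext a
  rw [ContinuousLinearMap.comp_apply, bidualAct_apply, Bidual.map_apply]
  refine (congrArg n ?_).trans (map_zero n)
  ext b
  simp [h]

instance : IsScalarTower ℂ (Bidual B) (Bidual B) :=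
  ⟨fun _ _ _ => rfl⟩

instance : SMulCommClass ℂ (Bidual B) (Bidual B) := by
  refine ⟨fun c m n => ?_⟩
  ext f
  rw [smul_eq_mul, smul_eq_mul, Bidual.smul_apply, Bidual.mul_apply, Bidual.mul_apply,
    ← smul_eq_mul, ← map_smul]
  rfl

variable [IsScalarTower ℂ A A] [SMulCommClass ℂ A A]

theorem Bidual.map_mul {T : A →L[ℂ] B} (hT : ∀ a b, T (a * b) = T a * T b) (m n : Bidual A) :
    Bidual.map T (m * n) = Bidual.map T m * Bidual.map T n := by
  ext f
  rw [Bidual.map_apply, Bidual.mul_apply, Bidual.mul_apply, Bidual.map_apply]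
  congr 1
  ext a
  rw [bidualAct_apply, ContinuousLinearMap.comp_apply, bidualAct_apply, Bidual.map_apply]
  congr 1
  ext b
  simp [hT]

/-- A multiplicative `f` is an eigenvector of both actions: `f · a = f a • f`, hence `n · f = n f •
f`, and `(m n) f = m (n · f)` becomes `n f * m f`. -/
theorem Bidual.eval_mul {f : StrongDual ℂ A} (hf : ∀ a b, f (a * b) = f a * f b)
    (m n : Bidual A) : Bidual.eval f (m * n) = Bidual.eval f m * Bidual.eval f n := by
  have h1 : ∀ a, dualAct f a = f a • f := fun a => by ext b; simp [hf]
  have h2 : bidualAct n f = n f • f := by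
    ext a
    rw [bidualAct_apply, h1, map_smul]
    simp [mul_comm]
  rw [Bidual.eval_apply, Bidual.mul_apply, h2, map_smul, smul_eq_mul, mul_comm]
  rfl

end BidualMap

/-! ### Algebras of `A`-valued functions -/

/-- Contractibility of an algebra `B` of `A`-valued functions on `X`, and of its second dual. Here
`ev x : B → A` is the evaluation at `x`, and the scalar functions `g` for which `a ↦ g a` maps
`A` to `B` are supposed to contain the constants, to separate the points of `X`, and to contain the
indicator functions of points if `X` is finite. -/
theorem contractible_functionAlgebra_iff {X : Type v} [Nonempty X] {A : Type u}
    [NonUnitalNormedRing A] [NormedSpace ℂ A] [IsScalarTower ℂ A A] [SMulCommClass ℂ A A]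
    [CompleteSpace A] {φ : A →L[ℂ] ℂ} (hφ : ∀ a b, φ (a * b) = φ a * φ b) (hφ0 : φ ≠ 0)
    {B : Type w} [NonUnitalNormedRing B] [NormedSpace ℂ B] [IsScalarTower ℂ B B]
    [SMulCommClass ℂ B B] (ev : X → B →L[ℂ] A)
    (hmul : ∀ x f g, ev x (f * g) = ev x f * ev x g) (hbd : ∀ x f, ‖ev x f‖ ≤ ‖f‖)
    (hext : ∀ f g, (∀ x, ev x f = ev x g) → f = g)
    (hone : ∃ j : A →L[ℂ] B, ∀ a x, ev x (j a) = a)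
    (hsep : ∀ x y, x ≠ y → ∃ g : X → ℂ, g x ≠ g y ∧ ∃ j : A →L[ℂ] B, ∀ a z, ev z (j a) = g z • a)
    (hsingle : Finite X → ∀ x, ∃ j : A →L[ℂ] B, (∀ a, ev x (j a) = a) ∧
      ∀ a y, y ≠ x → ev y (j a) = 0) :
    (IsContractibleAlgebra B ↔ Finite X ∧ IsContractibleAlgebra A) ∧
    (IsContractibleAlgebra (Bidual B) ↔ Finite X ∧ IsContractibleAlgebra (Bidual A)) := by
  obtain ⟨c, hc⟩ := hone
  obtain ⟨x₀⟩ := ‹Nonempty X›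
  obtain ⟨a₀, ha₀⟩ : ∃ a, φ a ≠ 0 := by
    by_contra! h
    exact hφ0 (ContinuousLinearMap.ext h)
  have hχm : ∀ x f g, φ.comp (ev x) (f * g) = φ.comp (ev x) f * φ.comp (ev x) g := fun x f g => by
    simp [hmul, hφ]
  have hχb : ∀ x, ‖φ.comp (ev x)‖ ≤ ‖φ‖ := fun x =>
    ContinuousLinearMap.opNorm_le_bound _ (norm_nonneg _) fun f =>
      (φ.le_opNorm _).trans (mul_le_mul_of_nonneg_left (hbd x f) (norm_nonneg _))
  have hχi : ∀ x y, (∀ f, φ.comp (ev x) f = φ.comp (ev y) f) → x = y := by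
    intro x y h
    by_contra hxy
    obtain ⟨g, hg, j, hj⟩ := hsep x y hxy
    have h1 := h (j a₀)
    simp only [ContinuousLinearMap.comp_apply, hj, map_smul, smul_eq_mul] at h1
    exact hg (mul_right_cancel₀ ha₀ h1)
  -- For finite `X`, each `f` is the sum of its values times the indicators of points, and distinct
  -- indicators have product zero.
  have hsum : Finite X → ∃ (_ : Fintype X) (j : X → A →L[ℂ] B),
      (∀ x a b, j x (a * b) = j x a * j x b) ∧ (∀ x y, x ≠ y → ∀ a b, j x a * j y b = 0) ∧
      ∀ f, ∑ x, j x (ev x f) = f := by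
    classical
    intro hX
    choose j hj hj' using hsingle hX
    have hev : ∀ x y a, ev y (j x a) = if y = x then a else 0 := fun x y a => by
      split_ifs with h
      · rw [h, hj]
      · exact hj' x a y h
    refine ⟨Fintype.ofFinite X, j, fun x a b => hext _ _ fun y => ?_,
      fun x y hxy a b => hext _ _ fun z => ?_, fun f => hext _ _ fun y => ?_⟩
    · rw [hmul, hev, hev, hev]
      split_ifs <;> simp
    · rw [hmul, hev, hev, map_zero]
      split_ifs with h1 h2
      · exact absurd (h1.symm.trans h2) hxy
      all_goals simp
    · simp [map_sum, hev]
  refine ⟨⟨fun h => ⟨?_, ?_⟩, ?_⟩, ⟨fun h => ⟨?_, ?_⟩, ?_⟩⟩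
  · exact h.finite_of_characters (fun x => φ.comp (ev x)) hχm hχb hχi
  · exact h.of_surjective (ev x₀) (hmul x₀) fun a => ⟨c a, hc a x₀⟩
  · rintro ⟨hX, hA⟩
    obtain ⟨_, j, h1, h2, h3⟩ := hsum hX
    exact hA.of_orthogonal_sum j (fun x f => ev x f) h1 h2 h3
  · refine h.finite_of_characters (fun x => Bidual.eval (φ.comp (ev x)))
      (fun x => Bidual.eval_mul (hχm x)) (C := ‖φ‖)
      (fun x => ContinuousLinearMap.opNorm_le_bound _ (norm_nonneg _) fun m => ?_)
      fun x y hxy => hχi x y fun f => ?_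
    · rw [Bidual.eval_apply, mul_comm]
      exact (m.le_opNorm _).trans (mul_le_mul_of_nonneg_left (hχb x) (norm_nonneg _))
    -- The characters of the second dual are already distinguished on the canonical image of `B`.
    · exact hxy (NormedSpace.inclusionInDoubleDual ℂ B f)
  -- Surjectivity of the second adjoint of `ev x₀` comes from its right inverse, the second adjoint
  -- of the inclusion `c` of constants.
  · exact h.of_surjective (Bidual.map (ev x₀)) (Bidual.map_mul (hmul x₀)) fun m =>
      ⟨Bidual.map c m, Bidual.map_map_of_leftInverse (fun a => hc a x₀) m⟩
  · rintro ⟨hX, hA⟩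
    obtain ⟨_, j, h1, h2, h3⟩ := hsum hX
    exact hA.of_orthogonal_sum (fun x => Bidual.map (j x)) (fun x m => Bidual.map (ev x) m)
      (fun x => Bidual.map_mul (h1 x)) (fun x y hxy => Bidual.map_mul_map_eq_zero (h2 x y hxy))
      (Bidual.sum_map_map h3)

/-! ### Evaluations and multiples of scalar functions in `Lip_α(X, A)` -/

namespace LipAlgebra

variable {α : ℝ} {X : Type v} [MetricSpace X] {A : Type u} [NonUnitalNormedRing A]
  [NormedSpace ℂ A]

/-- Evaluation at a point. -/
noncomputable def eval (x : X) : LipAlgebra α X A →L[ℂ] A :=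
  LinearMap.mkContinuous
    { toFun := fun f => f x
      map_add' := fun _ _ => rfl
      map_smul' := fun _ _ => rfl } 1 fun f => by
    rw [one_mul, norm_def]
    exact (f.norm_apply_le_supNorm x).trans (le_add_of_nonneg_right f.lipSeminorm_nonneg)

theorem norm_eval_le (x : X) (f : LipAlgebra α X A) : ‖eval x f‖ ≤ ‖f‖ := by
  rw [norm_def]
  exact (f.norm_apply_le_supNorm x).trans (le_add_of_nonneg_right f.lipSeminorm_nonneg)

theorem norm_smul_sub_smul_le (g : LipAlgebra α X ℂ) (a : A) (x y : X) :
    ‖g x • a - g y • a‖ ≤ (g.lipSeminorm * ‖a‖) * dist x y ^ α := by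
  rw [← sub_smul, norm_smul, mul_right_comm]
  exact mul_le_mul_of_nonneg_right (g.norm_sub_le x y) (norm_nonneg a)

theorem norm_smul_le_supNorm (g : LipAlgebra α X ℂ) (a : A) (x : X) :
    ‖g x • a‖ ≤ g.supNorm * ‖a‖ := by
  rw [norm_smul]
  exact mul_le_mul_of_nonneg_right (g.norm_apply_le_supNorm x) (norm_nonneg a)

/-- The map `a ↦ g a` from `A` to `Lip_α(X, A)`, for a scalar function `g`. -/
noncomputable def smulRight (g : LipAlgebra α X ℂ) : A →L[ℂ] LipAlgebra α X A :=
  LinearMap.mkContinuous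
    { toFun := fun a => ⟨fun x => g x • a, ⟨_, g.norm_smul_le_supNorm a⟩,
        ⟨_, g.norm_smul_sub_smul_le a⟩⟩
      map_add' := fun a b => ext fun x => smul_add (g x) a b
      map_smul' := fun c a => ext fun x => smul_comm (g x) c a } ‖g‖ fun a => by
    rw [norm_def, norm_def, add_mul]
    exact add_le_add
      (supNorm_le _ (mul_nonneg g.supNorm_nonneg (norm_nonneg a)) (g.norm_smul_le_supNorm a))
      (lipSeminorm_le _ (mul_nonneg g.lipSeminorm_nonneg (norm_nonneg a))
        (g.norm_smul_sub_smul_le a))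

@[simp] theorem smulRight_apply (g : LipAlgebra α X ℂ) (a : A) (x : X) :
    smulRight g a x = g x • a := rfl

theorem smulRight_mem_littleLip {g : LipAlgebra α X ℂ} (hg : g ∈ littleLip α X ℂ) (a : A) :
    smulRight g a ∈ littleLip α X A := by
  intro ε hε
  -- The `+ 1` keeps the denominator positive when `a = 0`.
  obtain ⟨δ, hδ, h⟩ := hg (ε / (‖a‖ + 1)) (by positivity)
  refine ⟨δ, hδ, fun x y h0 hxy => ?_⟩
  have h1 := (lt_div_iff₀ (by positivity)).1 (h x y h0 hxy)
  have h2 := g.quot_nonneg (x, y)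
  rw [smulRight_apply, smulRight_apply, ← sub_smul, norm_smul, mul_div_right_comm]
  simp only [LipAlgebra.quot] at h2
  nlinarith

end LipAlgebra

/-! ### Scalar functions: constants, truncated distances, finite spaces -/

section ScalarFunctions

variable {α : ℝ} {X : Type v} [MetricSpace X]

theorem const_one_mem : (fun _ : X => (1 : ℂ)) ∈ lipschitzFunctions α X ℂ :=
  ⟨⟨1, by simp⟩, 0, by simp⟩

theorem const_one_mem_littleLip : (⟨_, const_one_mem⟩ : LipAlgebra α X ℂ) ∈ littleLip α X ℂ :=
  fun ε hε => ⟨1, one_pos, fun x y _ _ => by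
    change ‖(1 : ℂ) - 1‖ / _ < ε
    simpa using hε⟩

/-- The function `y ↦ min (d(x, y)) 1`. -/
noncomputable def truncDist (x y : X) : ℂ := (min (dist x y) 1 : ℝ)

theorem norm_truncDist_le (x y : X) : ‖truncDist x y‖ ≤ 1 := by
  rw [truncDist, Complex.norm_real, Real.norm_of_nonneg (by positivity)]
  exact min_le_right _ _

theorem norm_truncDist_sub_le (x y z : X) : ‖truncDist x y - truncDist x z‖ ≤ min (dist y z) 1 := by
  rw [truncDist, truncDist, ← Complex.ofReal_sub, Complex.norm_real, Real.norm_eq_abs]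
  have h1 := dist_triangle x y z
  have h2 := dist_triangle x z y
  rw [dist_comm z y] at h2
  have h3 : 0 ≤ dist x y := dist_nonneg
  have h4 : 0 ≤ dist x z := dist_nonneg
  have h5 : 0 ≤ dist y z := dist_nonneg
  rw [abs_le]
  constructor <;> rcases min_cases (dist x y) 1 with h | h <;>
    rcases min_cases (dist x z) 1 with h' | h' <;> rcases min_cases (dist y z) 1 with h'' | h'' <;>
    linarith

/-- Truncation at `1` covers both ranges: `t ≤ t ^ α` for `t ≤ 1`, and `1 ≤ t ^ α` beyond. Hence
truncated distances are bounded and `α`-Lipschitz whenever `0 < α ≤ 1`. -/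
theorem min_one_le_rpow {t : ℝ} (ht : 0 ≤ t) (h0 : 0 < α) (h1 : α ≤ 1) : min t 1 ≤ t ^ α := by
  rcases le_total t 1 with h | h
  · exact (min_le_left _ _).trans (Real.self_le_rpow_of_le_one ht h h1)
  · exact (min_le_right _ _).trans (Real.one_le_rpow h h0.le)

theorem truncDist_mem (h0 : 0 < α) (h1 : α ≤ 1) (x : X) :
    truncDist x ∈ lipschitzFunctions α X ℂ :=
  ⟨⟨1, norm_truncDist_le x⟩, 1, fun y z => by
    rw [one_mul]
    exact (norm_truncDist_sub_le x y z).trans (min_one_le_rpow dist_nonneg h0 h1)⟩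

theorem truncDist_mem_littleLip (h0 : 0 < α) (h1 : α < 1) (x : X) :
    (⟨_, truncDist_mem h0 h1.le x⟩ : LipAlgebra α X ℂ) ∈ littleLip α X ℂ := by
  intro ε hε
  -- The difference quotient is at most `d ^ (1 - α)`, which is below `ε` exactly when `d < ε ^ (1 /
  -- (1 - α))`.
  refine ⟨ε ^ (1 - α)⁻¹, Real.rpow_pos_of_pos hε _, fun y z hyz hδ => ?_⟩
  have h2 : 0 < 1 - α := sub_pos.2 h1
  rw [div_lt_iff₀ (Real.rpow_pos_of_pos hyz α)]
  refine ((norm_truncDist_sub_le x y z).trans (min_le_left _ _)).trans_lt ?_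
  have h3 : dist y z ^ (1 - α) < ε := by
    have := Real.rpow_lt_rpow hyz.le hδ h2
    rwa [← Real.rpow_mul hε.le, inv_mul_cancel₀ h2.ne', Real.rpow_one] at this
  calc dist y z = dist y z ^ (1 - α) * dist y z ^ α := by
        rw [← Real.rpow_add hyz, sub_add_cancel, Real.rpow_one]
    _ < ε * dist y z ^ α := mul_lt_mul_of_pos_right h3 (Real.rpow_pos_of_pos hyz α)

theorem truncDist_ne {x y : X} (h : x ≠ y) : truncDist x x ≠ truncDist x y := by
  have h1 : 0 < min (dist x y) 1 := lt_min (dist_pos.2 h) one_pos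
  rw [truncDist, truncDist, dist_self, min_eq_left zero_le_one, Ne, Complex.ofReal_inj]
  exact h1.ne

theorem exists_dist_lower_bound [Finite X] : ∃ δ > 0, ∀ x y : X, x ≠ y → δ ≤ dist x y := by
  rcases Set.eq_empty_or_nonempty {p : X × X | p.1 ≠ p.2} with h0 | h0
  · refine ⟨1, one_pos, fun x y hxy => ?_⟩
    exact absurd (show (x, y) ∈ {p : X × X | p.1 ≠ p.2} from hxy) (by simp [h0])
  · obtain ⟨p, hp, hmin⟩ :=
      Set.exists_min_image _ (fun p : X × X => dist p.1 p.2) (Set.toFinite _) h0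
    exact ⟨_, dist_pos.2 hp, fun x y hxy => hmin (x, y) hxy⟩

theorem mem_lipschitzFunctions_of_finite [Finite X] (hα : 0 < α) (g : X → ℂ) :
    g ∈ lipschitzFunctions α X ℂ := by
  obtain ⟨δ, hδ, h⟩ := exists_dist_lower_bound (X := X)
  obtain ⟨C, hC⟩ := (Set.finite_range fun x => ‖g x‖).bddAbove
  replace hC : ∀ x, ‖g x‖ ≤ C := fun x => hC ⟨x, rfl⟩
  -- Distinct points are at least `δ` apart and values differ by at most `2 * C`.
  refine ⟨⟨C, hC⟩, 2 * C / δ ^ α, fun x y => ?_⟩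
  rcases eq_or_ne x y with rfl | hxy
  · simp [hα.ne']
  · have hC0 : 0 ≤ C := (norm_nonneg _).trans (hC x)
    have h1 : δ ^ α ≤ dist x y ^ α := Real.rpow_le_rpow hδ.le (h x y hxy) hα.le
    have h2 : 0 < δ ^ α := Real.rpow_pos_of_pos hδ α
    calc ‖g x - g y‖ ≤ C + C := (norm_sub_le _ _).trans (add_le_add (hC x) (hC y))
      _ = 2 * C / δ ^ α * δ ^ α := by field_simp; ring
      _ ≤ _ := mul_le_mul_of_nonneg_left h1 (by positivity)

/-- The condition is vacuous: no two distinct points are closer than the minimal distance. -/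
theorem mem_littleLip_of_finite [Finite X] (g : LipAlgebra α X ℂ) : g ∈ littleLip α X ℂ := by
  obtain ⟨δ, hδ, h⟩ := exists_dist_lower_bound (X := X)
  exact fun ε _ => ⟨δ, hδ, fun x y h0 hxy => absurd hxy (h x y (dist_pos.1 h0)).not_gt⟩

end ScalarFunctions

/-! ### The function-algebra criterion applied to `Lip_α(X, A)` and `lip_α(X, A)` -/

section Lipschitz

variable {α : ℝ} {X : Type v} [MetricSpace X] {A : Type u} [NonUnitalNormedRing A]
  [NormedSpace ℂ A]

variable (α X A) in
/-- The isometric inclusion of `lip_α(X, A)` into `Lip_α(X, A)`. -/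
def littleLip.inclusion : littleLip α X A →ₗᵢ[ℂ] LipAlgebra α X A where
  toFun := Subtype.val
  map_add' _ _ := rfl
  map_smul' _ _ := rfl
  norm_map' _ := rfl

/-- Evaluation at a point. -/
noncomputable def littleLip.eval (x : X) : littleLip α X A →L[ℂ] A :=
  (LipAlgebra.eval x).comp (littleLip.inclusion α X A).toContinuousLinearMap

theorem littleLip.eval_mul (x : X) (f g : littleLip α X A) :
    littleLip.eval x (f * g) = littleLip.eval x f * littleLip.eval x g := rfl

theorem littleLip.norm_eval_le (x : X) (f : littleLip α X A) : ‖littleLip.eval x f‖ ≤ ‖f‖ :=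
  LipAlgebra.norm_eval_le x f.1

theorem littleLip.exists_smulRight {g : LipAlgebra α X ℂ} (hg : g ∈ littleLip α X ℂ) :
    ∃ j : A →L[ℂ] littleLip α X A, ∀ a z, littleLip.eval z (j a) = g z • a := by
  obtain ⟨j, hj⟩ := (littleLip.inclusion α X A).exists_lift (LipAlgebra.smulRight g)
    fun a => ⟨⟨_, LipAlgebra.smulRight_mem_littleLip hg a⟩, rfl⟩
  exact ⟨j, fun a z => congrArg (LipAlgebra.eval z) (hj a)⟩

variable [Nonempty X] [IsScalarTower ℂ A A] [SMulCommClass ℂ A A] [CompleteSpace A]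

theorem contractible_lipAlgebra_iff (hα : 0 < α) {φ : A →L[ℂ] ℂ}
    (hφ : ∀ a b, φ (a * b) = φ a * φ b) (hφ0 : φ ≠ 0)
    (hsep : ∀ x y : X, x ≠ y → ∃ f : LipAlgebra α X ℂ, f x ≠ f y) :
    (IsContractibleAlgebra (LipAlgebra α X A) ↔ Finite X ∧ IsContractibleAlgebra A) ∧
    (IsContractibleAlgebra (Bidual (LipAlgebra α X A)) ↔
      Finite X ∧ IsContractibleAlgebra (Bidual A)) := by
  classical
  refine contractible_functionAlgebra_iff hφ hφ0 LipAlgebra.eval (fun _ _ _ => rfl)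
    LipAlgebra.norm_eval_le (fun f g h => LipAlgebra.ext h)
    ⟨LipAlgebra.smulRight ⟨_, const_one_mem⟩, fun a x => one_smul ℂ a⟩ (fun x y hxy => ?_)
    fun _ x => ?_
  · obtain ⟨g, hg⟩ := hsep x y hxy
    exact ⟨g, hg, LipAlgebra.smulRight g, fun _ _ => rfl⟩
  · refine ⟨LipAlgebra.smulRight ⟨_, mem_lipschitzFunctions_of_finite hα (Pi.single x 1)⟩,
      fun a => ?_, fun a y hy => ?_⟩
    · change (Pi.single x 1 : X → ℂ) x • a = a
      simp
    · change (Pi.single x 1 : X → ℂ) y • a = 0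
      simp [hy]

theorem contractible_littleLip_iff (hα : 0 < α) {φ : A →L[ℂ] ℂ}
    (hφ : ∀ a b, φ (a * b) = φ a * φ b) (hφ0 : φ ≠ 0)
    (hsep : ∀ x y : X, x ≠ y → ∃ f ∈ littleLip α X ℂ, f x ≠ f y) :
    (IsContractibleAlgebra (littleLip α X A) ↔ Finite X ∧ IsContractibleAlgebra A) ∧
    (IsContractibleAlgebra (Bidual (littleLip α X A)) ↔
      Finite X ∧ IsContractibleAlgebra (Bidual A)) := by
  classical
  refine contractible_functionAlgebra_iff hφ hφ0 littleLip.eval littleLip.eval_mul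
    littleLip.norm_eval_le (fun _ _ h => Subtype.ext (LipAlgebra.ext h)) ?_
    (fun x y hxy => ?_) fun _ x => ?_
  · obtain ⟨j, hj⟩ := littleLip.exists_smulRight (A := A)
      (const_one_mem_littleLip (α := α) (X := X))
    exact ⟨j, fun a x => (hj a x).trans (one_smul ℂ a)⟩
  · obtain ⟨g, hg, hne⟩ := hsep x y hxy
    exact ⟨g, hne, littleLip.exists_smulRight hg⟩
  · let g : LipAlgebra α X ℂ := ⟨_, mem_lipschitzFunctions_of_finite hα (Pi.single x 1)⟩
    obtain ⟨j, hj⟩ := littleLip.exists_smulRight (A := A) (mem_littleLip_of_finite g)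
    refine ⟨j, fun a => (hj a x).trans ?_, fun a y hy => (hj a y).trans ?_⟩
    · change (Pi.single x 1 : X → ℂ) x • a = a
      simp
    · change (Pi.single x 1 : X → ℂ) y • a = 0
      simp [hy]

end Lipschitz

/-- Multiplicative linear functionals on a Banach algebra are automatically continuous, so the
non-emptiness of `Δ(A)` is that of the character space. The bounds on `α` serve only to make
truncated distances available as separating functions. -/
theorem theorem3p8 {X : Type v} [MetricSpace X] [Nonempty X] {A : Type u}
    [NonUnitalNormedRing A] [NormedSpace ℂ A] [IsScalarTower ℂ A A] [SMulCommClass ℂ A A]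
    [CompleteSpace A] (hA : (WeakDual.characterSpace ℂ A).Nonempty) {α : ℝ} (hα : 0 < α) :
    ((α < 1 ∨ ∀ x y : X, x ≠ y → ∃ f ∈ littleLip α X ℂ, f x ≠ f y) →
      [IsContractibleAlgebra (LipAlgebra α X A),
        IsContractibleAlgebra (littleLip α X A),
        Finite X ∧ IsContractibleAlgebra A].TFAE ∧
      [IsContractibleAlgebra (Bidual (LipAlgebra α X A)),
        IsContractibleAlgebra (Bidual (littleLip α X A)),
        Finite X ∧ IsContractibleAlgebra (Bidual A)].TFAE) ∧
    ((α ≤ 1 ∨ ∀ x y : X, x ≠ y → ∃ f : LipAlgebra α X ℂ, f x ≠ f y) →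
      (IsContractibleAlgebra (LipAlgebra α X A) ↔ Finite X ∧ IsContractibleAlgebra A) ∧
      (IsContractibleAlgebra (Bidual (LipAlgebra α X A)) ↔
        Finite X ∧ IsContractibleAlgebra (Bidual A))) := by
  obtain ⟨ψ, hψ0, hψ⟩ := hA
  let φ : A →L[ℂ] ℂ := ⟨⟨⟨ψ, map_add ψ⟩, map_smul ψ⟩, ψ.2⟩
  have hφ0 : φ ≠ 0 := fun h => hψ0 <|
    DFunLike.ext _ _ fun a => congrArg (fun f : A →L[ℂ] ℂ => f a) h
  have hφ : ∀ a b, φ (a * b) = φ a * φ b := hψ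
  refine ⟨fun h => ?_, fun h => ?_⟩
  · have hs : ∀ x y : X, x ≠ y → ∃ f ∈ littleLip α X ℂ, f x ≠ f y := by
      rcases h with h | h
      · exact fun x y hxy => ⟨_, truncDist_mem_littleLip hα h x, truncDist_ne hxy⟩
      · exact h
    obtain ⟨h1, h2⟩ := contractible_littleLip_iff hα hφ hφ0 hs
    -- Separation by `lip_α` gives separation by the larger algebra `Lip_α`.
    obtain ⟨h3, h4⟩ := contractible_lipAlgebra_iff hα hφ hφ0 fun x y hxy =>
      (hs x y hxy).imp fun _ h => h.2
    constructor
    · tfae_have 1 ↔ 3 := h3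
      tfae_have 2 ↔ 3 := h1
      tfae_finish
    · tfae_have 1 ↔ 3 := h4
      tfae_have 2 ↔ 3 := h2
      tfae_finish
  · refine contractible_lipAlgebra_iff hα hφ hφ0 ?_
    rcases h with h | h
    · exact fun x y hxy => ⟨⟨_, truncDist_mem hα h x⟩, truncDist_ne hxy⟩
    · exact h
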